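/- Let $g$ and $h$ be entire functions whose orders of growth lie in $(0,1)$, with $g(0)=h(0)=1$. Here the order of an entire function $f$ is the infimum of all $\rho\ge 0$ such that $|f(z)|\le e^{|z|^\rho}$ whenever $|z|$ is sufficiently large. Suppose that the zeros of $g$ are exactly the numbers $a_1<a_2<\cdots$ and the zeros of $h$ are exactly the numbers $b_1<b_2<\cdots$, that all these zeros are simple, that $a_n,b_n>0$, that $a_n\to\infty$ and $b_n\to\infty$, and that $a_n<b_n$ for every $n\ge 1$. Then $g(it)\neq 0$ for all $t\in\mathbb{R}$, and there is a probability measure $\mu$ on $[0,\infty)$ whose characteristic function is $$\int e^{itx}\,\mu(dx)=\frac{h(it)}{g(it)},\qquad t\in\mathbb{R}.$$ Moreover, $\mu$ is the infinite convolution of the probability measures $$P_n=\frac{a_n}{b_n}\,\delta_0+\Bigl(1-\frac{a_n}{b_n}\Bigr)\mathrm{Exp}(a_n),\qquad n\ge 1,$$ where $\delta_0$ is the unit mass at $0$ and $\mathrm{Exp}(a)$ is the exponential law with density $a e^{-ax}$ on $[0,\infty)$. That is, the finite convolutions $P_1\star\cdots\star P_N$ converge weakly to $\mu$ as $N\to\infty$,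 and the products $\prod_{n=1}^{N}\int e^{itx}\,P_n(dx)$ converge to $h(it)/g(it)$ uniformly on every bounded interval of $t$. -/

import Mathlib

open MeasureTheory ProbabilityTheory Filter Topology
open scoped NNReal ENNReal

noncomputable section

/-- The order of growth of `f : ℂ → ℂ`: the infimum of the exponents `ρ ≥ 0` such that
`|f z| ≤ exp (|z| ^ ρ)` for all `z` with `|z|` large enough (`∞` if there is no such `ρ`). -/
def entireOrder (f : ℂ → ℂ) : ℝ≥0∞ :=
  ⨅ (ρ : ℝ≥0)
    (_ : ∀ᶠ r : ℝ in atTop, ∀ z : ℂ, ‖z‖ = r → ‖f z‖ ≤ Real.exp (r ^ (ρ : ℝ))), (ρ : ℝ≥0∞)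

/-- `a 0 < a 1 < ⋯` are positive numbers tending to infinity. -/
structure IsIncreasingPositiveSeq (a : ℕ → ℝ) : Prop where
  pos : ∀ n, 0 < a n
  strictMono : StrictMono a
  tendsto : Tendsto a atTop atTop

/-- The zeros of `f` are exactly the numbers `a n`, and each of them is a simple zero. -/
structure HasSimpleZeros (f : ℂ → ℂ) (a : ℕ → ℝ) : Prop where
  zero_iff : ∀ z : ℂ, f z = 0 ↔ ∃ n, z = (a n : ℂ)
  simple : ∀ n, analyticOrderAt f (a n : ℂ) = 1

/-- The measure `(a / b) δ₀ + (1 - a / b) Exp(a)`. -/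
def expMixtureMeasure (a b : ℝ) : Measure ℝ :=
  ENNReal.ofReal (a / b) • Measure.dirac 0 + ENNReal.ofReal (1 - a / b) • expMeasure a

theorem isProbabilityMeasure_expMixtureMeasure {a b : ℝ} (ha : 0 < a) (hab : a < b) :
    IsProbabilityMeasure (expMixtureMeasure a b) := by
  have := isProbabilityMeasure_expMeasure ha
  have h0 : 0 ≤ a / b := (div_pos ha (ha.trans hab)).le
  have h1 : 0 ≤ 1 - a / b := sub_nonneg.2 ((div_le_one (ha.trans hab)).2 hab.le)
  constructor
  simp only [expMixtureMeasure, Measure.coe_add, Measure.coe_smul, Pi.add_apply, Pi.smul_apply,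
    measure_univ, smul_eq_mul, mul_one]
  rw [← ENNReal.ofReal_add h0 h1]
  simp

/-- The mixture as a probability measure, for `0 < a < b`. -/
def expMixture (a b : ℝ) (ha : 0 < a) (hab : a < b) : ProbabilityMeasure ℝ :=
  ⟨expMixtureMeasure a b, isProbabilityMeasure_expMixtureMeasure ha hab⟩

/-- The convolution of two probability measures on `ℝ`. -/
def probConv (P Q : ProbabilityMeasure ℝ) : ProbabilityMeasure ℝ :=
  ⟨Measure.conv (P : Measure ℝ) (Q : Measure ℝ), inferInstance⟩

/-- `partialConv P N` is the finite convolution `P 0 ⋆ P 1 ⋆ ⋯ ⋆ P (N - 1)`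
(the unit mass at `0` for `N = 0`). -/
def partialConv (P : ℕ → ProbabilityMeasure ℝ) : ℕ → ProbabilityMeasure ℝ
  | 0 => ⟨Measure.dirac 0, inferInstance⟩
  | N + 1 => probConv (partialConv P N) (P N)

/-- `μ` is the convergent infinite convolution of `P 0, P 1, …`: the finite convolutions
converge weakly to `μ`, and the product of the characteristic functions converges to the
characteristic function of `μ` uniformly on every bounded interval. -/
structure IsInfiniteConvolution (P : ℕ → ProbabilityMeasure ℝ) (μ : ProbabilityMeasure ℝ) :
    Prop where
  tendsto_partialConv : Tendsto (partialConv P) atTop (𝓝 μ)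
  tendstoUniformlyOn_prod : ∀ T : ℝ,
    TendstoUniformlyOn (fun (N : ℕ) (t : ℝ) => ∏ n ∈ Finset.range N, charFun (P n : Measure ℝ) t)
      (charFun (μ : Measure ℝ)) atTop (Set.Icc (-T) T)

end

/-! Order below one leaves no exponential factor in Hadamard's product, so `g z` is the limit of the
products of `1 - z / a n`, and likewise for `h`. Hence `h (it) / g (it)` is the limit of the
products of `(1 - it / b n) / (1 - it / a n)`, and each factor is the characteristic function of an
exponential mixture (`charFun_expMixture`). Lévy's theorem turns this limit into a weak limit of the
convolutions.

For the product formula (`HasSimpleZeros.tendstoUniformlyOn_prod`), divide out the first `N` zeros.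
The cofactor `k` is zero-free on `|z| < a N` and, by the maximum principle, at most `exp ((2 * a N)
^ ρ)` there, with `ρ < 1`. Borel–Carathéodory then gives a logarithm of `k` of size `O((a N) ^ (ρ -
1))` on a fixed disc, so `k` tends to `1`. -/

/-! ### Hadamard products for order below one -/

/-- A zero-free holomorphic function on a disc has a holomorphic logarithm there. -/
theorem exists_differentiableOn_exp_eq {f : ℂ → ℂ} {R : ℝ}
    (hf : DifferentiableOn ℂ f (Metric.ball 0 R))
    (h0 : ∀ z ∈ Metric.ball (0 : ℂ) R, f z ≠ 0) (hf0 : f 0 = 1) (hR : 0 < R) :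
    ∃ φ : ℂ → ℂ, DifferentiableOn ℂ φ (Metric.ball 0 R) ∧ φ 0 = 0 ∧
      ∀ z ∈ Metric.ball (0 : ℂ) R, f z = Complex.exp (φ z) := by
  have hd : DifferentiableOn ℂ (fun z => deriv f z / f z) (Metric.ball 0 R) :=
    (hf.deriv Metric.isOpen_ball).div hf h0
  obtain ⟨φ, hφ0, hφ⟩ := hd.isExactOn_ball.with_val_at 0 0
  refine ⟨φ, fun z hz => (hφ z hz).differentiableAt.differentiableWithinAt, hφ0, fun z hz => ?_⟩
  -- Since `φ' = f' / f`, the function `f * exp (-φ)` is constant.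
  have hder : ∀ w ∈ Metric.ball (0 : ℂ) R,
      HasDerivAt (fun w => f w * Complex.exp (-φ w)) 0 w := by
    intro w hw
    have h1 := (hf.differentiableAt (Metric.isOpen_ball.mem_nhds hw)).hasDerivAt
    have h2 := h1.mul (hφ w hw).neg.cexp
    refine h2.congr_deriv ?_
    linear_combination -Complex.exp (-φ w) * mul_div_cancel₀ (deriv f w) (h0 w hw)
  have hc : f z * Complex.exp (-φ z) = f 0 * Complex.exp (-φ 0) :=
    Metric.isOpen_ball.is_const_of_deriv_eq_zero (convex_ball 0 R).isPreconnected
      (fun w hw => (hder w hw).differentiableAt.differentiableWithinAt)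
      (fun w hw => (hder w hw).deriv) hz (Metric.mem_ball_self hR)
  rw [hf0, hφ0, neg_zero, Complex.exp_zero, mul_one, Complex.exp_neg] at hc
  have := Complex.exp_ne_zero (φ z)
  field_simp at hc
  exact hc

/-- A bounded zero-free holomorphic function on a disc, normalised at the centre, is the exponential
of a function obeying the Borel–Carathéodory estimate. -/
theorem exists_exp_eq_norm_le {f : ℂ → ℂ} {R M : ℝ} (hf : DifferentiableOn ℂ f (Metric.ball 0 R))
    (h0 : ∀ z ∈ Metric.ball (0 : ℂ) R, f z ≠ 0) (hf0 : f 0 = 1) (hR : 0 < R) (hM : 0 < M)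
    (hb : ∀ z ∈ Metric.ball (0 : ℂ) R, ‖f z‖ ≤ Real.exp M) {z : ℂ} (hz : ‖z‖ < R) :
    ∃ w : ℂ, f z = Complex.exp w ∧ ‖w‖ ≤ 2 * M * ‖z‖ / (R - ‖z‖) := by
  obtain ⟨φ, hφ, hφ0, he⟩ := exists_differentiableOn_exp_eq hf h0 hf0 hR
  have hz' : z ∈ Metric.ball (0 : ℂ) R := by simpa using hz
  refine ⟨φ z, he z hz', Complex.borelCaratheodory_zero hM hφ (fun w hw => ?_) hR hz' hφ0⟩
  have := hb w hw
  rwa [he w hw, Complex.norm_exp, Real.exp_le_exp] at this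

/-- Dividing an entire function by a linear factor at a zero. -/
theorem exists_entire_eq_one_sub_div_mul {f : ℂ → ℂ} (hf : Differentiable ℂ f) {c : ℂ} (hc : c ≠ 0)
    (hfc : f c = 0) :
    ∃ k : ℂ → ℂ, Differentiable ℂ k ∧ ∀ z, f z = (1 - z / c) * k z := by
  refine ⟨fun z => -c * dslope f c z, ?_, fun z => ?_⟩
  · have h := (Complex.differentiableOn_dslope (s := Set.univ) (c := c) univ_mem).2
      hf.differentiableOn
    exact (differentiableOn_univ.1 h).const_mul _
  · have := sub_smul_dslope f c z
    rw [hfc, sub_zero, smul_eq_mul] at this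
    rw [← this]
    field_simp
    ring

/-- Splitting off the first `N` zeros. -/
theorem HasSimpleZeros.exists_factorization {f : ℂ → ℂ} {a : ℕ → ℝ} (hz : HasSimpleZeros f a)
    (hf : Differentiable ℂ f) (ha : IsIncreasingPositiveSeq a) (N : ℕ) :
    ∃ k : ℂ → ℂ, Differentiable ℂ k ∧
      ∀ z, f z = (∏ n ∈ Finset.range N, (1 - z / (a n : ℂ))) * k z := by
  induction N with
  | zero => exact ⟨f, hf, by simp⟩
  | succ N ih =>
    obtain ⟨k, hk, he⟩ := ih
    have hne : ∀ n, (a n : ℂ) ≠ 0 := fun n => by exact_mod_cast (ha.pos n).ne'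
    have hkN : k (a N) = 0 := by
      have h1 := he (a N)
      rw [(hz.zero_iff _).2 ⟨N, rfl⟩] at h1
      refine (mul_eq_zero.1 h1.symm).resolve_left (Finset.prod_ne_zero_iff.2 fun n hn h => ?_)
      rw [sub_eq_zero, eq_div_iff (hne n), one_mul] at h
      exact (ha.strictMono (Finset.mem_range.1 hn)).ne (by exact_mod_cast h)
    obtain ⟨l, hl, hkl⟩ := exists_entire_eq_one_sub_div_mul hk (hne N) hkN
    exact ⟨l, hl, fun z => by rw [he, hkl, Finset.prod_range_succ, mul_assoc]⟩

/-- A zero of `k` in this disc would be some `a n` with `n < N`, where the product vanishes too; the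
order of `f` there would be at least two. -/
theorem HasSimpleZeros.factor_ne_zero {f k : ℂ → ℂ} {a : ℕ → ℝ} (hz : HasSimpleZeros f a)
    (ha : IsIncreasingPositiveSeq a) {N : ℕ} (hk : Differentiable ℂ k)
    (he : ∀ z, f z = (∏ n ∈ Finset.range N, (1 - z / (a n : ℂ))) * k z) {z : ℂ} (hzN : ‖z‖ < a N) :
    k z ≠ 0 := by
  intro h0
  have hne : ∀ n, (a n : ℂ) ≠ 0 := fun n => by exact_mod_cast (ha.pos n).ne'
  obtain ⟨n, rfl⟩ := (hz.zero_iff z).1 (by rw [he, h0, mul_zero])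
  rw [Complex.norm_real, Real.norm_of_nonneg (ha.pos n).le] at hzN
  have hn : n < N := ha.strictMono.lt_iff_lt.1 hzN
  have hp : Differentiable ℂ (fun z : ℂ => ∏ n ∈ Finset.range N, (1 - z / (a n : ℂ))) := by
    fun_prop
  have hpa := hp.analyticAt (a n : ℂ)
  have hka := hk.analyticAt (a n : ℂ)
  have h1 := analyticOrderAt_mul hpa hka
  have h2 : (fun z : ℂ => ∏ n ∈ Finset.range N, (1 - z / (a n : ℂ))) * k = f :=
    funext fun z => (he z).symm
  rw [h2, hz.simple n] at h1
  have h3 : analyticOrderAt (fun z : ℂ => ∏ n ∈ Finset.range N, (1 - z / (a n : ℂ))) (a n) ≠ 0 :=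
    hpa.analyticOrderAt_ne_zero.2
      (Finset.prod_eq_zero (Finset.mem_range.2 hn) (by rw [div_self (hne n), sub_self]))
  have h4 : analyticOrderAt k (a n) ≠ 0 := hka.analyticOrderAt_ne_zero.2 h0
  have h5 := add_le_add (Order.one_le_iff_ne_zero.2 h3) (Order.one_le_iff_ne_zero.2 h4)
  rw [← h1] at h5
  exact absurd h5 (by decide)

theorem one_le_norm_one_sub_div {z c : ℂ} (hc : c ≠ 0) (h : 2 * ‖c‖ ≤ ‖z‖) : 1 ≤ ‖1 - z / c‖ := by
  have h1 : 2 ≤ ‖z / c‖ := by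
    rwa [norm_div, le_div_iff₀ (norm_pos_iff.2 hc)]
  have := norm_sub_norm_le (z / c) 1
  rw [norm_one, norm_sub_rev] at this
  linarith

/-- The remaining factor inherits the growth bound of the function, by the maximum principle. -/
theorem norm_factor_le {f k : ℂ → ℂ} {a : ℕ → ℝ} (ha : IsIncreasingPositiveSeq a) {N : ℕ}
    (hk : Differentiable ℂ k)
    (he : ∀ z, f z = (∏ n ∈ Finset.range N, (1 - z / (a n : ℂ))) * k z) {C : ℝ}
    (hC : ∀ z : ℂ, ‖z‖ = 2 * a N → ‖f z‖ ≤ C) {z : ℂ} (hz : ‖z‖ ≤ 2 * a N) : ‖k z‖ ≤ C := by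
  have hpos : 2 * a N ≠ 0 := by have := ha.pos N; positivity
  refine Complex.norm_le_of_forall_mem_frontier_norm_le
    (Metric.isBounded_ball (x := 0) (r := 2 * a N))
    hk.diffContOnCl (fun w hw => ?_) ?_
  · rw [frontier_ball _ hpos, mem_sphere_zero_iff_norm] at hw
    have h1 : 1 ≤ ‖∏ n ∈ Finset.range N, (1 - w / (a n : ℂ))‖ := by
      rw [norm_prod]
      rw [← Finset.prod_const_one (s := Finset.range N)]
      refine Finset.prod_le_prod (fun _ _ => zero_le_one) fun n hn =>
        one_le_norm_one_sub_div ?_ ?_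
      · exact_mod_cast (ha.pos n).ne'
      · rw [Complex.norm_real, Real.norm_of_nonneg (ha.pos n).le, hw]
        have := ha.strictMono (Finset.mem_range.1 hn)
        linarith
    have h2 := hC w hw
    rw [he, norm_mul] at h2
    exact (le_mul_of_one_le_left (norm_nonneg _) h1).trans h2
  · rw [closure_ball _ hpos]
    simpa using hz

theorem exists_growth_of_entireOrder_lt_one {f : ℂ → ℂ} (hf : entireOrder f < 1) :
    ∃ ρ : ℝ, ρ < 1 ∧ ∀ᶠ r : ℝ in atTop, ∀ z : ℂ, ‖z‖ = r → ‖f z‖ ≤ Real.exp (r ^ ρ) := by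
  simp only [entireOrder, iInf_lt_iff] at hf
  obtain ⟨ρ, h, hρ⟩ := hf
  exact ⟨ρ, by exact_mod_cast hρ, h⟩

/-- This is the Borel–Carathéodory bound with `M = (2 * R) ^ ρ` at radius `T`. It decays like `R ^
(ρ - 1)`, which is where order below one enters. -/
theorem tendsto_growth_ratio {ρ : ℝ} (h1 : ρ < 1) (T : ℝ) :
    Tendsto (fun R : ℝ => 2 * (2 * R) ^ ρ * T / (R - T)) atTop (𝓝 0) := by
  have h2 : Tendsto (fun R : ℝ => 2 * 2 ^ ρ * T * R ^ (-(1 - ρ)) * (R / (R - T))) atTop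
      (𝓝 (2 * 2 ^ ρ * T * 0 * 1)) := by
    refine ((tendsto_rpow_neg_atTop (sub_pos.2 h1)).const_mul _).mul ?_
    have h3 : Tendsto (fun R : ℝ => 1 + T * (R - T)⁻¹) atTop (𝓝 (1 + T * 0)) :=
      ((tendsto_inv_atTop_zero.comp (tendsto_atTop_add_const_right _ (-T) tendsto_id)).const_mul
        T).const_add 1
    rw [mul_zero, add_zero] at h3
    refine h3.congr' ?_
    filter_upwards [eventually_gt_atTop T] with R hR
    have : R - T ≠ 0 := (sub_pos.2 hR).ne'
    field_simp
    ring
  rw [mul_zero, zero_mul] at h2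
  refine h2.congr' ?_
  filter_upwards [eventually_gt_atTop 0] with R hR
  rw [Real.mul_rpow zero_le_two hR.le, show -(1 - ρ) = ρ - 1 by ring, Real.rpow_sub hR,
    Real.rpow_one]
  field_simp

/-- **Hadamard factorization** for entire functions of order less than one with simple positive
zeros. -/
theorem HasSimpleZeros.tendstoUniformlyOn_prod {f : ℂ → ℂ} {a : ℕ → ℝ} (hz : HasSimpleZeros f a)
    (hf : Differentiable ℂ f) (ha : IsIncreasingPositiveSeq a) (hord : entireOrder f < 1)
    (hf0 : f 0 = 1) (T : ℝ) :
    TendstoUniformlyOn (fun (N : ℕ) (z : ℂ) => ∏ n ∈ Finset.range N, (1 - z / (a n : ℂ))) f atTop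
      (Metric.closedBall 0 T) := by
  obtain ⟨ρ, hρ1, hgr⟩ := exists_growth_of_entireOrder_lt_one hord
  obtain ⟨C, hC⟩ := (isCompact_closedBall (0 : ℂ) T).exists_bound_of_continuousOn
    hf.continuous.continuousOn
  have hlim := (tendsto_growth_ratio hρ1 T).comp ha.tendsto
  rw [Metric.tendstoUniformlyOn_iff]
  intro ε hε
  have h2 : Tendsto (fun N => 2 * a N) atTop atTop := ha.tendsto.const_mul_atTop two_pos
  -- The `1` allows `‖exp w - 1‖ ≤ 2 * ‖w‖`; the other term makes the final error `ε`, with `|C| +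
  -- 1` avoiding a zero denominator.
  have hδ : 0 < min 1 (ε / (2 * (|C| + 1))) := by positivity
  filter_upwards [h2.eventually hgr, hlim.eventually (gt_mem_nhds hδ),
    ha.tendsto.eventually_gt_atTop T] with N hN hsmall hNT z hzT
  rw [mem_closedBall_zero_iff] at hzT
  obtain ⟨k, hk, he⟩ := hz.exists_factorization hf ha N
  have haN := ha.pos N
  have hk0 : k 0 = 1 := by have := he 0; simpa [hf0] using this.symm
  -- Zero-freeness holds up to radius `a N`, but growth is measured at `2 * a N`, where every
  -- removed factor has modulus at least one.
  obtain ⟨w, hw, hwn⟩ := exists_exp_eq_norm_le (R := a N) (M := (2 * a N) ^ ρ) hk.differentiableOn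
    (fun z hz' => hz.factor_ne_zero ha hk he (by simpa using hz')) hk0 haN (by positivity)
    (fun z hz' => norm_factor_le ha hk he hN (by
      have : ‖z‖ < a N := by simpa using hz'
      linarith)) (hzT.trans_lt hNT)
  have hle : ‖w‖ ≤ 2 * (2 * a N) ^ ρ * T / (a N - T) := by
    refine hwn.trans ?_
    have := sub_pos.2 hNT
    have := (norm_nonneg z).trans hzT
    gcongr
  have hw' : ‖w‖ < min 1 (ε / (2 * (|C| + 1))) := hle.trans_lt hsmall
  have hp : ∏ n ∈ Finset.range N, (1 - z / (a n : ℂ)) = f z * Complex.exp (-w) := by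
    rw [he z, hw, mul_assoc, ← Complex.exp_add, add_neg_cancel, Complex.exp_zero, mul_one]
  have hfz : ‖f z‖ ≤ |C| := (hC z (by simpa using hzT)).trans (le_abs_self C)
  have hexp : ‖Complex.exp (-w) - 1‖ ≤ 2 * ‖w‖ := by
    have := Complex.norm_exp_sub_one_le (x := -w) (by
      rw [norm_neg]; exact hw'.le.trans (min_le_left _ _))
    rwa [norm_neg] at this
  rw [hp, dist_comm, dist_eq_norm,
    show f z * Complex.exp (-w) - f z = f z * (Complex.exp (-w) - 1) by ring, norm_mul]
  calc ‖f z‖ * ‖Complex.exp (-w) - 1‖ ≤ |C| * (2 * ‖w‖) := by gcongr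
    _ ≤ (|C| + 1) * (2 * ‖w‖) := by gcongr; linarith
    _ < (|C| + 1) * (2 * (ε / (2 * (|C| + 1)))) := by
        gcongr
        exact hw'.trans_le (min_le_right _ _)
    _ = ε := by field_simp

/-! ### Characteristic functions of the mixtures and their convolutions -/

theorem charFun_expMeasure {a : ℝ} (ha : 0 < a) (t : ℝ) :
    charFun (expMeasure a) t = a / (a - Complex.I * t) := by
  -- The exponential law is by definition the gamma law of shape `1`; an `ℝ≥0`-valued density turns
  -- the integral into a weighted Lebesgue integral.
  have hpdf : gammaPDF 1 a
      = fun x => ((Real.toNNReal (exponentialPDFReal a x) : ℝ≥0) : ℝ≥0∞) := rfl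
  have hre : (-(a : ℂ) + Complex.I * t).re < 0 := by simpa using ha
  have hne : (a : ℂ) - Complex.I * t ≠ 0 := fun h => by
    have := congrArg Complex.re h
    simp at this
    exact ha.ne' this
  rw [charFun_apply_real, expMeasure, gammaMeasure]
  rw [hpdf, integral_withDensity_eq_integral_smul (measurable_exponentialPDFReal a).real_toNNReal]
  have hind : (fun x : ℝ =>
        Real.toNNReal (exponentialPDFReal a x) • Complex.exp (t * x * Complex.I))
      = (Set.Ici (0 : ℝ)).indicator
        (fun x : ℝ => (a : ℂ) * Complex.exp ((-(a : ℂ) + Complex.I * t) * x)) := by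
    funext x
    rw [NNReal.smul_def, Real.coe_toNNReal _ (exponentialPDFReal_nonneg ha x)]
    by_cases hx : 0 ≤ x
    · rw [Set.indicator_of_mem (Set.mem_Ici.2 hx)]
      have h1 : exponentialPDFReal a x = a * Real.exp (-(a * x)) := by
        simp [exponentialPDFReal, gammaPDFReal, hx]
      rw [h1, Complex.real_smul]
      push_cast
      rw [mul_assoc, ← Complex.exp_add]
      congr 2
      ring
    · rw [Set.indicator_of_notMem (by simpa using hx)]
      simp [exponentialPDFReal, gammaPDFReal, hx]
  rw [hind, integral_indicator measurableSet_Ici, integral_Ici_eq_integral_Ioi,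
    integral_const_mul, integral_exp_mul_complex_Ioi hre]
  have hne' : -(a : ℂ) + Complex.I * t ≠ 0 := fun h => hne (by linear_combination -h)
  simp only [Complex.ofReal_zero, mul_zero, Complex.exp_zero]
  field_simp
  ring

theorem charFun_expMixture {a b : ℝ} (ha : 0 < a) (hab : a < b) (t : ℝ) :
    charFun (expMixture a b ha hab : Measure ℝ) t
      = (1 - Complex.I * t / b) / (1 - Complex.I * t / a) := by
  have := isProbabilityMeasure_expMeasure ha
  have hb := ha.trans hab
  have h0 : 0 ≤ a / b := (div_pos ha hb).le
  have h1 : 0 ≤ 1 - a / b := sub_nonneg.2 ((div_le_one hb).2 hab.le)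
  have hne : (a : ℂ) - Complex.I * t ≠ 0 := fun h => by
    have := congrArg Complex.re h
    simp at this
    exact ha.ne' this
  have haC : (a : ℂ) ≠ 0 := by exact_mod_cast ha.ne'
  have hbC : (b : ℂ) ≠ 0 := by exact_mod_cast hb.ne'
  have hint : ∀ (ν : Measure ℝ) [IsProbabilityMeasure ν] (c : ℝ≥0∞), c ≠ ∞ →
      Integrable (fun x : ℝ => Complex.exp (t * x * Complex.I)) (c • ν) := by
    intro ν _ c hc
    refine Integrable.smul_measure ?_ hc
    refine (integrable_const (1 : ℝ)).mono (by fun_prop) (ae_of_all _ fun x => ?_)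
    rw [← Complex.ofReal_mul, Complex.norm_exp_ofReal_mul_I, norm_one]
  have hmix : (expMixture a b ha hab : Measure ℝ) = expMixtureMeasure a b := rfl
  have hexp := charFun_expMeasure ha t
  rw [charFun_apply_real] at hexp
  rw [hmix, charFun_apply_real, expMixtureMeasure,
    integral_add_measure (hint _ _ ENNReal.ofReal_ne_top) (hint _ _ ENNReal.ofReal_ne_top),
    integral_smul_measure, integral_smul_measure, hexp, integral_dirac,
    ENNReal.toReal_ofReal h0, ENNReal.toReal_ofReal h1]
  have hden : 1 - Complex.I * t / a ≠ 0 := by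
    rw [show 1 - Complex.I * t / a = (a - Complex.I * t) / a by field_simp]
    exact div_ne_zero hne haC
  simp only [Complex.real_smul, Complex.ofReal_zero, mul_zero, zero_mul, Complex.exp_zero]
  push_cast
  rw [eq_div_iff hden]
  field_simp
  ring

theorem charFun_partialConv (P : ℕ → ProbabilityMeasure ℝ) (N : ℕ) (t : ℝ) :
    charFun (partialConv P N : Measure ℝ) t
      = ∏ n ∈ Finset.range N, charFun (P n : Measure ℝ) t := by
  induction N with
  | zero =>
    change charFun (Measure.dirac (0 : ℝ)) t = _
    simp
  | succ N ih =>
    change charFun (Measure.conv (partialConv P N : Measure ℝ) (P N : Measure ℝ)) t = _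
    rw [charFun_conv, ih, Finset.prod_range_succ]

/-! ### Support in the half-line -/

theorem expMixture_Iio_zero {a b : ℝ} (ha : 0 < a) (hab : a < b) :
    (expMixture a b ha hab : Measure ℝ) (Set.Iio 0) = 0 := by
  change expMixtureMeasure a b (Set.Iio 0) = 0
  have h : expMeasure a (Set.Iio 0) = 0 := by
    rw [expMeasure, gammaMeasure, withDensity_apply _ measurableSet_Iio]
    exact lintegral_gammaPDF_of_nonpos le_rfl
  simp [expMixtureMeasure, h]

theorem partialConv_Iio_zero {P : ℕ → ProbabilityMeasure ℝ}
    (hP : ∀ n, (P n : Measure ℝ) (Set.Iio 0) = 0) (N : ℕ) :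
    (partialConv P N : Measure ℝ) (Set.Iio 0) = 0 := by
  induction N with
  | zero =>
    change Measure.dirac (0 : ℝ) (Set.Iio 0) = 0
    simp
  | succ N ih =>
    change ((partialConv P N : Measure ℝ).conv (P N : Measure ℝ)) (Set.Iio 0) = 0
    rw [Measure.conv, Measure.map_apply (by fun_prop) measurableSet_Iio]
    -- A negative sum has a negative summand.
    refine measure_mono_null (t := Set.Iio 0 ×ˢ Set.univ ∪ Set.univ ×ˢ Set.Iio 0) ?_ ?_
    · rintro ⟨x, y⟩ hxy
      simp only [Set.mem_preimage, Set.mem_Iio] at hxy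
      simp only [Set.mem_union, Set.mem_prod, Set.mem_Iio, Set.mem_univ, and_true, true_and]
      by_contra! h
      linarith [h.1, h.2]
    · rw [measure_union_null_iff, Measure.prod_prod, Measure.prod_prod, ih, hP]
      simp

/-- Portmanteau: the mass of an open set is at most the liminf of its masses. -/
theorem ProbabilityMeasure.Iio_zero_of_tendsto {ν : ℕ → ProbabilityMeasure ℝ}
    {μ : ProbabilityMeasure ℝ} (h : Tendsto ν atTop (𝓝 μ))
    (h0 : ∀ n, (ν n : Measure ℝ) (Set.Iio 0) = 0) : (μ : Measure ℝ) (Set.Iio 0) = 0 := by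
  have h1 := ProbabilityMeasure.le_liminf_measure_open_of_tendsto h (isOpen_Iio (a := (0 : ℝ)))
  simpa [h0] using h1

/-! ### Lévy's continuity theorem -/

theorem ProbabilityMeasure.continuous_charFun (t : ℝ) :
    Continuous fun μ : ProbabilityMeasure ℝ => charFun (μ : Measure ℝ) t := by
  rw [continuous_iff_continuousAt]
  intro μ
  have h := (ProbabilityMeasure.tendsto_iff_forall_integral_rclike_tendsto ℂ).1
    (tendsto_id (x := 𝓝 μ))
  simp only [ContinuousAt, charFun_eq_integral_innerProbChar]
  exact h (BoundedContinuousFunction.innerProbChar t)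

/-- **Lévy's continuity theorem** on the line: a pointwise limit of characteristic functions that is
continuous at `0` is the characteristic function of the weak limit. -/
theorem ProbabilityMeasure.exists_tendsto_of_tendsto_charFun {ν : ℕ → ProbabilityMeasure ℝ}
    {f : ℝ → ℂ} (hf : ContinuousAt f 0)
    (h : ∀ t, Tendsto (fun n => charFun (ν n : Measure ℝ) t) atTop (𝓝 (f t))) :
    ∃ μ : ProbabilityMeasure ℝ, charFun (μ : Measure ℝ) = f ∧ Tendsto ν atTop (𝓝 μ) := by
  -- Continuity at `0` gives tightness, so Prokhorov's theorem supplies a cluster point `μ`.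
  have ht := isTightMeasureSet_of_tendsto_charFun hf h
  have hc : IsCompact (closure (Set.range ν)) := by
    refine isCompact_closure_of_isTightMeasureSet ?_
    convert ht using 1
    ext; simp
  obtain ⟨μ, -, hμ⟩ := hc.exists_mapClusterPt (u := ν) (f := atTop)
    (tendsto_principal.2 (Eventually.of_forall fun n => subset_closure (Set.mem_range_self n)))
  have hμf : charFun (μ : Measure ℝ) = f := by
    funext t
    have h1 := MapClusterPt.continuousAt_comp
      (ProbabilityMeasure.continuous_charFun t).continuousAt hμ
    -- `charFun μ t` is a cluster point of a sequence converging to `f t`, so the two agree.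
    exact eq_of_nhds_neBot (ClusterPt.mono h1 (h t))
  exact ⟨μ, hμf, ProbabilityMeasure.tendsto_of_tendsto_charFun fun t => hμf ▸ h t⟩

/-! ### The quotient on the imaginary axis -/

theorem HasSimpleZeros.apply_I_mul_ne_zero {f : ℂ → ℂ} {a : ℕ → ℝ} (hz : HasSimpleZeros f a)
    (ha : IsIncreasingPositiveSeq a) (t : ℝ) : f (Complex.I * t) ≠ 0 := by
  intro h
  obtain ⟨n, hn⟩ := (hz.zero_iff _).1 h
  have := congrArg Complex.re hn
  simp at this
  exact (ha.pos n).ne this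

theorem HasSimpleZeros.tendstoLocallyUniformlyOn_prod_I_mul {f : ℂ → ℂ} {a : ℕ → ℝ}
    (hz : HasSimpleZeros f a) (hf : Differentiable ℂ f) (ha : IsIncreasingPositiveSeq a)
    (hord : entireOrder f < 1) (hf0 : f 0 = 1) (T : ℝ) :
    TendstoLocallyUniformlyOn
      (fun (N : ℕ) (t : ℝ) => ∏ n ∈ Finset.range N, (1 - Complex.I * t / (a n : ℂ)))
      (fun t => f (Complex.I * t)) atTop (Set.Icc (-T) T) := by
  have h := (hz.tendstoUniformlyOn_prod hf ha hord hf0 T).comp fun t : ℝ => Complex.I * t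
  refine (h.mono fun t ht => ?_).tendstoLocallyUniformlyOn
  simpa [abs_le] using ht

theorem tendstoUniformlyOn_prod_charFun_expMixture (g h : ℂ → ℂ) (a b : ℕ → ℝ)
    (hg : Differentiable ℂ g) (hh : Differentiable ℂ h)
    (hg_order : entireOrder g < 1) (hh_order : entireOrder h < 1)
    (hg0 : g 0 = 1) (hh0 : h 0 = 1)
    (ha : IsIncreasingPositiveSeq a) (hb : IsIncreasingPositiveSeq b)
    (hga : HasSimpleZeros g a) (hhb : HasSimpleZeros h b)
    (hab : ∀ n, a n < b n) (T : ℝ) :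
    TendstoUniformlyOn (fun (N : ℕ) (t : ℝ) => ∏ n ∈ Finset.range N,
        charFun (expMixture (a n) (b n) (ha.pos n) (hab n) : Measure ℝ) t)
      (fun t => h (Complex.I * t) / g (Complex.I * t)) atTop (Set.Icc (-T) T) := by
  -- Locally uniform limits of quotients need only continuous limits and a nonvanishing denominator;
  -- compactness makes this uniform.
  rw [← tendstoLocallyUniformlyOn_iff_tendstoUniformlyOn_of_compact isCompact_Icc]
  simp_rw [charFun_expMixture, Finset.prod_div_distrib]
  have hcont : ∀ {f : ℂ → ℂ}, Differentiable ℂ f →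
      ContinuousOn (fun t : ℝ => f (Complex.I * t)) (Set.Icc (-T) T) := fun hf =>
    (hf.continuous.comp (by fun_prop)).continuousOn
  exact (hhb.tendstoLocallyUniformlyOn_prod_I_mul hh hb hh_order hh0 T).div₀
    (hga.tendstoLocallyUniformlyOn_prod_I_mul hg ha hg_order hg0 T)
    (hcont hh) (hcont hg) fun t _ => hga.apply_I_mul_ne_zero ha t

theorem mainTheorem3 (g h : ℂ → ℂ) (a b : ℕ → ℝ)
    (hg : Differentiable ℂ g) (hh : Differentiable ℂ h)
    (hg_order : entireOrder g ∈ Set.Ioo (0 : ℝ≥0∞) 1)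
    (hh_order : entireOrder h ∈ Set.Ioo (0 : ℝ≥0∞) 1)
    (hg0 : g 0 = 1) (hh0 : h 0 = 1)
    (ha : IsIncreasingPositiveSeq a) (hb : IsIncreasingPositiveSeq b)
    (hga : HasSimpleZeros g a) (hhb : HasSimpleZeros h b)
    (hab : ∀ n, a n < b n) :
    ∃ μ : ProbabilityMeasure ℝ,
      (μ : Measure ℝ) (Set.Iio 0) = 0 ∧
      (∀ t : ℝ, g (Complex.I * t) ≠ 0 ∧
        charFun (μ : Measure ℝ) t = h (Complex.I * t) / g (Complex.I * t)) ∧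
      IsInfiniteConvolution (fun n => expMixture (a n) (b n) (ha.pos n) (hab n)) μ := by
  have hunif := tendstoUniformlyOn_prod_charFun_expMixture g h a b hg hh hg_order.2 hh_order.2
    hg0 hh0 ha hb hga hhb hab
  have hne := hga.apply_I_mul_ne_zero ha
  have hcont : Continuous fun t : ℝ => h (Complex.I * t) / g (Complex.I * t) :=
    (hh.continuous.comp (by fun_prop)).div (hg.continuous.comp (by fun_prop)) hne
  obtain ⟨μ, hμ, hlim⟩ := ProbabilityMeasure.exists_tendsto_of_tendsto_charFun
    (ν := partialConv fun n => expMixture (a n) (b n) (ha.pos n) (hab n)) hcont.continuousAt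
    fun t => by
      simp_rw [charFun_partialConv]
      exact (hunif |t|).tendsto_at (Set.mem_Icc.2 ⟨neg_abs_le t, le_abs_self t⟩)
  exact ⟨μ, ProbabilityMeasure.Iio_zero_of_tendsto hlim
      (partialConv_Iio_zero fun n => expMixture_Iio_zero (ha.pos n) (hab n)),
    fun t => ⟨hne t, by rw [hμ]⟩, hlim, fun T => hμ ▸ hunif T⟩
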